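/- Let $X$ be a separable Banach space with a non-degenerate centered Gaussian measure $\mu$, and let $H$ be its Cameron–Martin space, i.e. the range $R_\mu(X^*_\mu)\subseteq X$, where $X^*_\mu$ is the closure of $X^*$ in $L^2(X,\mu)$ and $R_\mu g=\int_X g(x)\,x\,d\mu(x)$, with the inner product $\langle R_\mu g_1,R_\mu g_2\rangle_H=\int_X g_1g_2\,d\mu$. Let $\mathscr{FC}^\infty_b(X)$ be the space of smooth cylindrical functions $f(x)=\varphi(l_1(x),\dots,l_n(x))$, where $n\in\mathbb N$, $l_1,\dots,l_n\in X^*$ and $\varphi\in C^\infty(\mathbb R^n)$ is bounded together with all its derivatives, and let $\nabla_H f(x)\in H$ be the gradient of $f$ along $H$ at $x$, i.e. the gradient at $0$ of $H\ni h\mapsto f(x+h)$. For $1\le q<\infty$ let $W^{1,q}(X,\mu)\subseteq L^q(X,\mu)$ be the completion of $\mathscr{FC}^\infty_b(X)$ in the norm $\|f\|_{L^q(X,\mu)}+\|\nabla_H f\|_{L^q(X,\mu;H)}$. Let $1<s<\infty$, let $s'=s/(s-1)$, let $s'<t<\infty$, and let $w:X\to\mathbb R$ be such that $w>0$ $\mu$-a.e.,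 $w\in W^{1,s}(X,\mu)$ and $\log w\in W^{1,t}(X,\mu)$. Put $\nu:=w\mu$. Then for every real $p\ge \frac{t}{t-s'}$ the gradient along $H$ is a well-defined linear operator $$\nabla_H:\mathscr{FC}^\infty_b(X)\subseteq L^p(X,\nu)\longrightarrow L^p(X,\nu;H)$$ (that is, every $f\in\mathscr{FC}^\infty_b(X)$ lies in $L^p(X,\nu)$, $\nabla_Hf$ lies in $L^p(X,\nu;H)$, and the class of $\nabla_H f$ depends only on the class of $f$), and it is closable in $L^p(X,\nu)$: the closure of its graph in $L^p(X,\nu)\times L^p(X,\nu;H)$ is the graph of a linear operator. -/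

import Mathlib

open MeasureTheory ProbabilityTheory Filter Topology
open scoped ENNReal ContDiff

noncomputable section

namespace WeightedGaussian

variable {X : Type*} [NormedAddCommGroup X] [NormedSpace ℝ X] [MeasurableSpace X] [BorelSpace X]

/-- The measure has mean zero: every continuous linear functional has mean zero. -/
def IsCentered (μ : Measure X) : Prop :=
  ∀ l : StrongDual ℝ X, ∫ x, l x ∂μ = 0

/-- No nonzero continuous linear functional is almost surely constant. -/
def IsNondegenerate (μ : Measure X) : Prop :=
  ∀ l : StrongDual ℝ X, l ≠ 0 → 0 < Var[l; μ]

/-- The Cameron–Martin space `H` of a centered Gaussian measure `μ`, as an abstract Hilbert space: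
the closure `X*_μ` of `X*` in `L²(X, μ)`. The covariance operator `covOp μ` below is injective on it
and identifies it with the Cameron–Martin subspace of `X`, whose inner product is by definition
`⟨R_μ g₁, R_μ g₂⟩_H = ⟨g₁, g₂⟩_{L²(X, μ)}`. -/
abbrev CameronMartin (μ : Measure X) : Type _ :=
  ↥((LinearMap.range (StrongDual.toLp (𝕜 := ℝ) μ 2).toLinearMap).topologicalClosure)

/-- The covariance operator `R_μ : X*_μ → X`, `R_μ g = ∫ g(x) x dμ(x)`: the inclusion of the
Cameron–Martin space into `X`. -/
def covOp (μ : Measure X) (g : CameronMartin μ) : X :=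
  ∫ x, ((g : Lp ℝ 2 μ) x) • x ∂μ

/-- `R_μ` is given by `l (R_μ g) = ∫ g l dμ` for `l ∈ X*`. -/
theorem apply_covOp [CompleteSpace X] [SecondCountableTopology X] (μ : Measure X) [IsGaussian μ]
    (g : CameronMartin μ) (l : StrongDual ℝ X) :
    l (covOp μ g) = ∫ x, (g : Lp ℝ 2 μ) x * l x ∂μ := by
  have hint : Integrable (fun x => ((g : Lp ℝ 2 μ) x) • x) μ :=
    memLp_one_iff_integrable.1
      ((IsGaussian.memLp_two_id (μ := μ)).smul (Lp.memLp (g : Lp ℝ 2 μ)) (p := 2) (r := 1))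
  rw [covOp, ← l.integral_comp_comm hint]
  simp

/-- `R_μ` is injective, so that it transports the Hilbert structure of `X*_μ` to its range. -/
theorem covOp_injective [CompleteSpace X] [SecondCountableTopology X] (μ : Measure X)
    [IsGaussian μ] : Function.Injective (covOp μ) := by
  intro g₁ g₂ h
  have key : ∀ g : CameronMartin μ, ∀ l : StrongDual ℝ X,
      inner ℝ (StrongDual.toLp μ 2 l) (g : Lp ℝ 2 μ) = l (covOp μ g) := by
    intro g l
    rw [apply_covOp, L2.inner_def, StrongDual.toLp_apply IsGaussian.memLp_two_id]
    refine integral_congr_ae ?_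
    filter_upwards [(IsGaussian.memLp_two_id.continuousLinearMap_comp l).coeFn_toLp (μ := μ)]
      with x hx
    refine (congrArg (fun a => inner ℝ a ((g : Lp ℝ 2 μ) x)) hx).trans ?_
    simp
  apply Subtype.ext
  rw [← sub_eq_zero]
  have hm : ((g₁ : Lp ℝ 2 μ) - g₂) ∈
      (LinearMap.range (StrongDual.toLp (𝕜 := ℝ) μ 2).toLinearMap).topologicalClosure :=
    Submodule.sub_mem _ g₁.2 g₂.2
  have ho : ((g₁ : Lp ℝ 2 μ) - g₂) ∈
      (LinearMap.range (StrongDual.toLp (𝕜 := ℝ) μ 2).toLinearMap).topologicalClosureᗮ := by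
    rw [Submodule.orthogonal_closure, Submodule.mem_orthogonal]
    rintro _ ⟨l, rfl⟩
    have := (key g₁ l).trans ((congrArg l h).trans (key g₂ l).symm)
    simp only [ContinuousLinearMap.coe_coe, inner_sub_right]
    exact sub_eq_zero.2 this
  exact inner_self_eq_zero.1 ((Submodule.mem_orthogonal _ _).1 ho _ hm)

/-- The gradient along `H` of `f` at `x`: the gradient at `0` of `h ↦ f (x + h)` on the Hilbert space
`H`. Fréchet differentiability at `0` of this map is convergence of the difference quotients
`(f (x + r h) - f x) / r → ⟨v, h⟩_H` uniformly in `|h|_H = 1`. -/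
def gradH (μ : Measure X) (f : X → ℝ) (x : X) : CameronMartin μ :=
  gradient (fun h : CameronMartin μ => f (x + covOp μ h)) 0

/-- Smooth cylindrical functions `f(x) = φ(l₁(x), …, lₙ(x))`, with `φ` smooth and bounded together
with all its derivatives, and `l₁, …, lₙ ∈ X*`. -/
def IsSmoothCylindrical (f : X → ℝ) : Prop :=
  ∃ (n : ℕ) (φ : (Fin n → ℝ) → ℝ) (l : Fin n → StrongDual ℝ X),
    ContDiff ℝ ∞ φ ∧ (∀ k : ℕ, ∃ C : ℝ, ∀ y, ‖iteratedFDeriv ℝ k φ y‖ ≤ C) ∧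
      ∀ x, f x = φ (fun i => l i x)

/-- `f` is a version of an element of the Gaussian Sobolev space `W^{1,p}(X, μ)`, the completion of
the smooth cylindrical functions in the norm `‖f‖_{L^p(X, μ)} + ‖∇_H f‖_{L^p(X, μ; H)}`, regarded as
a subspace of `L^p(X, μ)`. -/
def MemSobolev (μ : Measure X) (p : ℝ≥0∞) (f : X → ℝ) : Prop :=
  MemLp f p μ ∧ ∃ Φ : X → CameronMartin μ, MemLp Φ p μ ∧ ∃ F : ℕ → X → ℝ,
    (∀ k, IsSmoothCylindrical (F k)) ∧
    Tendsto (fun k => eLpNorm (fun x => F k x - f x) p μ) atTop (𝓝 0) ∧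
    Tendsto (fun k => eLpNorm (fun x => gradH μ (F k) x - Φ x) p μ) atTop (𝓝 0)

/-- The weighted measure `ν = w μ`. -/
def weighted (μ : Measure X) (w : X → ℝ) : Measure X :=
  μ.withDensity (fun x => ENNReal.ofReal (w x))

end WeightedGaussian

end

/-! Closability follows from integration by parts against `ν`. Let `l ∈ X*`, let `h = R_μ l ∈ H`,
and let `Φ` be the Sobolev gradient of `log w`. For bounded `C¹` functions `G` with bounded
derivative, `∫ ∂_h G dν = ∫ G β_l dν`, where `β_l = l - ⟨Φ, h⟩_H`. Both terms of `β_l` lie in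
`L^t(μ)`, hence in `L^{t/s'}(ν)` by Hölder, as `w ∈ L^s(μ)`. The condition `p ≥ t/(t-s')` says
exactly that `p' ≤ t/s'`, so `β_l ∈ L^{p'}(ν)`.

If `f_k → 0` in `L^p(ν)` and `∇_H f_k → Θ`, the formula for `G = f_k g` gives `∫ g ⟨∇_H f_k, h⟩ dν =
∫ f_k (g β_l - ∂_h g) dν → 0`. Thus `⟨Θ, h⟩` is orthogonal to every test function `g` and vanishes
a.e.; density of `X*` in `X*_μ` then gives `Θ = 0` (`snd_eq_zero_of_mem_closure_gradGraph`).

The formula for `ν` comes in three stages. Rotation invariance of `μ ⊗ μ` gives the Gaussian one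
(`integral_fderiv_covOp`). It is applied to `G ψ(F_k)` with `F_k → log w` in the Sobolev norm and
`ψ` bounded `C¹` (`integral_mul_comp_of_sobolev`). Finally `ψ` increases to `exp`, and `exp (log w)
= w` appears as the density (`integral_fderiv_weighted`). The class `IsBoundedC1` contains the
cylindrical functions and is stable under the products and compositions needed here. -/

noncomputable section

namespace WeightedGaussian

/-! ### Test functions, cylindrical functions and the gradient along `H`. -/

section FunctionClasses

variable {X : Type*} [NormedAddCommGroup X] [NormedSpace ℝ X]

/-- A `C¹` function which is bounded and has a bounded derivative. -/
structure IsBoundedC1 (f : X → ℝ) : Prop where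
  contDiff : ContDiff ℝ 1 f
  bounded : ∃ C, ∀ x, ‖f x‖ ≤ C
  bounded_fderiv : ∃ C, ∀ x, ‖fderiv ℝ f x‖ ≤ C

namespace IsBoundedC1

variable {f g : X → ℝ}

theorem differentiable (hf : IsBoundedC1 f) : Differentiable ℝ f :=
  hf.contDiff.differentiable one_ne_zero

theorem continuous (hf : IsBoundedC1 f) : Continuous f :=
  hf.contDiff.continuous

theorem continuous_fderiv (hf : IsBoundedC1 f) : Continuous (fderiv ℝ f) :=
  hf.contDiff.continuous_fderiv one_ne_zero

theorem fderiv_mul_apply (hf : IsBoundedC1 f) (hg : IsBoundedC1 g) (x h : X) :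
    fderiv ℝ (fun y => f y * g y) x h = f x * fderiv ℝ g x h + g x * fderiv ℝ f x h := by
  rw [fderiv_fun_mul (hf.differentiable x) (hg.differentiable x)]
  simp

theorem mul (hf : IsBoundedC1 f) (hg : IsBoundedC1 g) : IsBoundedC1 (fun x => f x * g x) := by
  obtain ⟨A, hA⟩ := hf.bounded
  obtain ⟨B, hB⟩ := hg.bounded
  obtain ⟨A', hA'⟩ := hf.bounded_fderiv
  obtain ⟨B', hB'⟩ := hg.bounded_fderiv
  refine ⟨hf.contDiff.mul hg.contDiff, ⟨A * B, fun x => ?_⟩, ⟨A * B' + B * A', fun x => ?_⟩⟩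
  · rw [norm_mul]
    exact mul_le_mul (hA x) (hB x) (norm_nonneg _) ((norm_nonneg _).trans (hA x))
  · rw [fderiv_fun_mul (hf.differentiable x) (hg.differentiable x)]
    refine (norm_add_le _ _).trans ?_
    rw [norm_smul, norm_smul]
    exact add_le_add
      (mul_le_mul (hA x) (hB' x) (norm_nonneg _) ((norm_nonneg _).trans (hA x)))
      (mul_le_mul (hB x) (hA' x) (norm_nonneg _) ((norm_nonneg _).trans (hB x)))

theorem comp {ψ : ℝ → ℝ} (hψ : IsBoundedC1 ψ) (hf : IsBoundedC1 f) :
    IsBoundedC1 (fun x => ψ (f x)) := by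
  obtain ⟨A, hA⟩ := hψ.bounded
  obtain ⟨A', hA'⟩ := hψ.bounded_fderiv
  obtain ⟨B', hB'⟩ := hf.bounded_fderiv
  refine ⟨hψ.contDiff.comp hf.contDiff, ⟨A, fun x => hA _⟩, ⟨A' * B', fun x => ?_⟩⟩
  have := fderiv_comp x (hψ.differentiable (f x)) (hf.differentiable x)
  rw [Function.comp_def] at this
  rw [this]
  exact (ContinuousLinearMap.opNorm_comp_le _ _).trans
    (mul_le_mul (hA' _) (hB' x) (norm_nonneg _) ((norm_nonneg _).trans (hA' (f x))))

theorem comp_continuousLinearMap {Y : Type*} [NormedAddCommGroup Y] [NormedSpace ℝ Y]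
    (hf : IsBoundedC1 f) (L : Y →L[ℝ] X) : IsBoundedC1 (fun y => f (L y)) := by
  obtain ⟨A, hA⟩ := hf.bounded
  obtain ⟨A', hA'⟩ := hf.bounded_fderiv
  refine ⟨hf.contDiff.comp L.contDiff, ⟨A, fun x => hA _⟩, ⟨A' * ‖L‖, fun x => ?_⟩⟩
  have := fderiv_comp x (hf.differentiable (L x)) L.differentiableAt
  rw [Function.comp_def] at this
  rw [this, L.fderiv]
  exact (ContinuousLinearMap.opNorm_comp_le _ _).trans (by gcongr; exact hA' _)

theorem of_deriv {ψ ψ' : ℝ → ℝ} (h : ∀ y, HasDerivAt ψ (ψ' y) y) (hc : Continuous ψ')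
    {A A' : ℝ} (hA : ∀ y, ‖ψ y‖ ≤ A) (hA' : ∀ y, ‖ψ' y‖ ≤ A') : IsBoundedC1 ψ := by
  have hd : deriv ψ = ψ' := funext fun y => (h y).deriv
  refine ⟨contDiff_one_iff_deriv.2 ⟨fun y => (h y).differentiableAt, hd ▸ hc⟩, ⟨A, hA⟩,
    ⟨A', fun y => ?_⟩⟩
  rw [← norm_deriv_eq_norm_fderiv, hd]
  exact hA' y

theorem memLp [MeasurableSpace X] [BorelSpace X]
    (hf : IsBoundedC1 f) (ν : Measure X) [IsFiniteMeasure ν] (q : ℝ≥0∞) :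
    MemLp f q ν := by
  obtain ⟨C, hC⟩ := hf.bounded
  exact MemLp.of_bound hf.continuous.aestronglyMeasurable C (ae_of_all _ hC)

end IsBoundedC1

theorem isBoundedC1_sin : IsBoundedC1 Real.sin :=
  .of_deriv Real.hasDerivAt_sin Real.continuous_cos Real.abs_sin_le_one Real.abs_cos_le_one

theorem isBoundedC1_cos : IsBoundedC1 Real.cos :=
  .of_deriv Real.hasDerivAt_cos Real.continuous_sin.neg Real.abs_cos_le_one
    (fun y => by rw [norm_neg]; exact Real.abs_sin_le_one y)

namespace IsSmoothCylindrical

variable {f g : X → ℝ}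

theorem isBoundedC1 (hf : IsSmoothCylindrical f) : IsBoundedC1 f := by
  obtain ⟨n, φ, l, hφ, hb, hfl⟩ := hf
  have h1 : IsBoundedC1 φ := by
    refine ⟨hφ.of_le (mod_cast le_top), ?_, ?_⟩
    · simpa only [norm_iteratedFDeriv_zero] using hb 0
    · simpa only [norm_iteratedFDeriv_one] using hb 1
  have h2 := h1.comp_continuousLinearMap (ContinuousLinearMap.pi l)
  have : f = fun x => φ (ContinuousLinearMap.pi l x) := funext hfl
  rw [this]
  exact h2

theorem zero : IsSmoothCylindrical (fun _ : X => (0 : ℝ)) :=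
  ⟨0, fun _ => 0, Fin.elim0, contDiff_const,
    fun k => ⟨0, fun y => by rw [show (fun _ : Fin 0 → ℝ => (0 : ℝ)) = 0 from rfl]; simp⟩, fun _ => rfl⟩

theorem const_smul (c : ℝ) (hf : IsSmoothCylindrical f) :
    IsSmoothCylindrical (fun x => c • f x) := by
  obtain ⟨n, φ, l, hφ, hb, hfl⟩ := hf
  refine ⟨n, fun y => c • φ y, l, hφ.const_smul c, fun k => ?_, fun x => by simp [hfl x]⟩
  obtain ⟨C, hC⟩ := hb k
  refine ⟨‖c‖ * C, fun y => ?_⟩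
  rw [show (fun y => c • φ y) = c • φ from rfl,
    iteratedFDeriv_const_smul_apply (hφ.contDiffAt.of_le (mod_cast le_top)), norm_smul]
  gcongr
  exact hC y

theorem exists_bound_iteratedFDeriv_comp_continuousLinearMap {E F : Type*}
    [NormedAddCommGroup E] [NormedSpace ℝ E] [NormedAddCommGroup F] [NormedSpace ℝ F]
    {φ : E → ℝ} (hφ : ContDiff ℝ ∞ φ)
    (hb : ∀ k : ℕ, ∃ C : ℝ, ∀ y, ‖iteratedFDeriv ℝ k φ y‖ ≤ C) (L : F →L[ℝ] E) (k : ℕ) :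
    ∃ C : ℝ, ∀ y, ‖iteratedFDeriv ℝ k (fun z => φ (L z)) y‖ ≤ C := by
  obtain ⟨C, hC⟩ := hb k
  refine ⟨C * ∏ _i : Fin k, ‖L‖, fun y => ?_⟩
  have := L.iteratedFDeriv_comp_right hφ y (i := k) (mod_cast le_top)
  rw [Function.comp_def] at this
  rw [this]
  refine (ContinuousMultilinearMap.norm_compContinuousLinearMap_le _ _).trans ?_
  gcongr
  exact hC _

/-- The two functions may depend on different functionals; concatenating the two lists makes both of
them functions of `n + m` common variables. -/
theorem add (hf : IsSmoothCylindrical f) (hg : IsSmoothCylindrical g) :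
    IsSmoothCylindrical (fun x => f x + g x) := by
  obtain ⟨n, φ, l, hφ, hb, hfl⟩ := hf
  obtain ⟨m, χ, r, hχ, hb', hgl⟩ := hg
  let P : (Fin (n + m) → ℝ) →L[ℝ] (Fin n → ℝ) :=
    ContinuousLinearMap.pi fun i => ContinuousLinearMap.proj (Fin.castAdd m i)
  let Q : (Fin (n + m) → ℝ) →L[ℝ] (Fin m → ℝ) :=
    ContinuousLinearMap.pi fun i => ContinuousLinearMap.proj (Fin.natAdd n i)
  have hP : ContDiff ℝ ∞ fun y => φ (P y) := hφ.comp P.contDiff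
  have hQ : ContDiff ℝ ∞ fun y => χ (Q y) := hχ.comp Q.contDiff
  refine ⟨n + m, fun y => φ (P y) + χ (Q y), Fin.append l r, hP.add hQ, fun k => ?_, fun x => ?_⟩
  · obtain ⟨C, hC⟩ := exists_bound_iteratedFDeriv_comp_continuousLinearMap hφ hb P k
    obtain ⟨D, hD⟩ := exists_bound_iteratedFDeriv_comp_continuousLinearMap hχ hb' Q k
    refine ⟨C + D, fun y => ?_⟩
    rw [show (fun y => φ (P y) + χ (Q y)) = (fun y => φ (P y)) + (fun y => χ (Q y)) from rfl,
      iteratedFDeriv_add_apply (hP.contDiffAt.of_le (mod_cast le_top))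
      (hQ.contDiffAt.of_le (mod_cast le_top))]
    exact (norm_add_le _ _).trans (add_le_add (hC y) (hD y))
  · have hPx : P (fun i => Fin.append l r i x) = fun i => l i x := by
      ext i
      simp [P]
    have hQx : Q (fun i => Fin.append l r i x) = fun i => r i x := by
      ext i
      simp [Q]
    simp only [hfl x, hgl x, hPx, hQx]

end IsSmoothCylindrical

variable [CompleteSpace X] [SecondCountableTopology X] [MeasurableSpace X] [BorelSpace X]
  (μ : Measure X) [IsGaussian μ]

theorem inner_toLp (l : StrongDual ℝ X) (g : CameronMartin μ) :
    inner ℝ (StrongDual.toLp μ 2 l) (g : Lp ℝ 2 μ) = l (covOp μ g) := by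
  rw [apply_covOp, L2.inner_def, StrongDual.toLp_apply IsGaussian.memLp_two_id]
  refine integral_congr_ae ?_
  filter_upwards [(IsGaussian.memLp_two_id.continuousLinearMap_comp l).coeFn_toLp (μ := μ)]
    with x hx
  refine (congrArg (fun a => inner ℝ a ((g : Lp ℝ 2 μ) x)) hx).trans ?_
  simp

/-- By duality: `l (R_μ g)` is the `L²` inner product of `l` and `g`, so Cauchy–Schwarz applies.
This makes the inclusion of `H` into `X` continuous, so that `∇_H` is obtained by the chain rule. -/
theorem norm_covOp_le (g : CameronMartin μ) :
    ‖covOp μ g‖ ≤ ‖StrongDual.toLp (𝕜 := ℝ) (E := X) μ 2‖ * ‖g‖ := by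
  refine NormedSpace.norm_le_dual_bound ℝ _ (by positivity) fun l => ?_
  rw [← inner_toLp]
  calc _ ≤ ‖StrongDual.toLp (𝕜 := ℝ) μ 2 l‖ * ‖(g : Lp ℝ 2 μ)‖ := norm_inner_le_norm _ _
    _ ≤ (‖StrongDual.toLp (𝕜 := ℝ) (E := X) μ 2‖ * ‖l‖) * ‖g‖ := by
        gcongr
        · exact ContinuousLinearMap.le_opNorm _ _
        · exact le_rfl
    _ = _ := by ring

/-- The covariance operator as a continuous linear map. -/
def covOpL : CameronMartin μ →L[ℝ] X :=
  LinearMap.mkContinuous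
    { toFun := covOp μ
      map_add' := fun g₁ g₂ => by
        refine (SeparatingDual.eq_iff_forall_dual_eq (R := ℝ)).2 fun l => ?_
        rw [map_add, ← inner_toLp, ← inner_toLp, ← inner_toLp, Submodule.coe_add, inner_add_right]
      map_smul' := fun c g => by
        refine (SeparatingDual.eq_iff_forall_dual_eq (R := ℝ)).2 fun l => ?_
        rw [RingHom.id_apply, map_smul, ← inner_toLp, ← inner_toLp, Submodule.coe_smul,
          inner_smul_right, smul_eq_mul] }
    _ (norm_covOp_le μ)

@[simp]
theorem covOpL_apply (g : CameronMartin μ) : covOpL μ g = covOp μ g := rfl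

variable {f g : X → ℝ}

theorem gradH_eq (hf : Differentiable ℝ f) (x : X) :
    gradH μ f x = (InnerProductSpace.toDual ℝ (CameronMartin μ)).symm
      ((fderiv ℝ f x).comp (covOpL μ)) := by
  have h1 : HasFDerivAt (fun h : CameronMartin μ => x + covOp μ h) (covOpL μ) 0 :=
    (covOpL μ).hasFDerivAt.const_add x
  have h0 : x + covOp μ 0 = x := by rw [← covOpL_apply, map_zero, add_zero]
  have h2 : HasFDerivAt f (fderiv ℝ f x) (x + covOp μ 0) := by
    rw [h0]
    exact (hf x).hasFDerivAt
  rw [gradH, gradient]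
  congr 1
  exact (h2.comp 0 h1).fderiv

theorem inner_gradH (hf : Differentiable ℝ f) (x : X) (h : CameronMartin μ) :
    inner ℝ (gradH μ f x) h = fderiv ℝ f x (covOp μ h) := by
  rw [gradH_eq μ hf, InnerProductSpace.toDual_symm_apply]
  rfl

theorem gradH_add (hf : Differentiable ℝ f) (hg : Differentiable ℝ g) (x : X) :
    gradH μ (fun y => f y + g y) x = gradH μ f x + gradH μ g x := by
  refine ext_inner_right ℝ fun h => ?_
  rw [inner_add_left, inner_gradH μ hf, inner_gradH μ hg, inner_gradH μ (hf.fun_add hg),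
    fderiv_fun_add (hf x) (hg x)]
  rfl

theorem gradH_const_smul (hf : Differentiable ℝ f) (c : ℝ) (x : X) :
    gradH μ (fun y => c • f y) x = c • gradH μ f x := by
  refine ext_inner_right ℝ fun h => ?_
  refine Eq.trans ?_ (real_inner_smul_left (gradH μ f x) h c).symm
  rw [inner_gradH μ hf, inner_gradH μ (hf.fun_const_smul c),
    fderiv_fun_const_smul (hf x)]
  rfl

theorem gradH_zero (x : X) : gradH μ (fun _ => (0 : ℝ)) x = 0 := by
  refine ext_inner_right ℝ fun h => ?_
  rw [inner_gradH μ (differentiable_const 0)]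
  simp

theorem IsBoundedC1.continuous_gradH (hf : IsBoundedC1 f) : Continuous (gradH μ f) := by
  rw [funext (gradH_eq μ hf.differentiable)]
  exact (LinearIsometryEquiv.continuous _).comp (hf.continuous_fderiv.clm_comp continuous_const)

theorem IsBoundedC1.bounded_gradH (hf : IsBoundedC1 f) : ∃ C, ∀ x, ‖gradH μ f x‖ ≤ C := by
  obtain ⟨C, hC⟩ := hf.bounded_fderiv
  refine ⟨C * ‖covOpL μ‖, fun x => ?_⟩
  rw [gradH_eq μ hf.differentiable, LinearIsometryEquiv.norm_map]
  exact (ContinuousLinearMap.opNorm_comp_le _ _).trans (by gcongr; exact hC x)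

theorem IsBoundedC1.memLp_gradH (hf : IsBoundedC1 f) (ν : Measure X) [IsFiniteMeasure ν]
    (q : ℝ≥0∞) : MemLp (gradH μ f) q ν := by
  obtain ⟨C, hC⟩ := hf.bounded_gradH μ
  -- Strong measurability of a continuous `H`-valued map is obtained from the second countability of
  -- `X`, so separability of `H` need not be established.
  have := secondCountableTopologyEither_of_left X (CameronMartin μ)
  exact MemLp.of_bound (hf.continuous_gradH μ).aestronglyMeasurable C (ae_of_all _ hC)

end FunctionClasses

/-! ### Gaussian integration by parts from rotation invariance. -/

section GaussianIntegrationByParts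

section

variable {X : Type*} [NormedAddCommGroup X] [NormedSpace ℝ X] {f : X → ℝ}

theorem hasDerivAt_rotation_integrand (hf : Differentiable ℝ f) (l : StrongDual ℝ X) (z : X × X)
    (θ : ℝ) :
    HasDerivAt (fun θ : ℝ => f (Real.cos θ • z.1 + Real.sin θ • z.2) *
        l (-Real.sin θ • z.1 + Real.cos θ • z.2))
      (fderiv ℝ f (Real.cos θ • z.1 + Real.sin θ • z.2) (-Real.sin θ • z.1 + Real.cos θ • z.2) *
          l (-Real.sin θ • z.1 + Real.cos θ • z.2) +
        f (Real.cos θ • z.1 + Real.sin θ • z.2) *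
          l (-Real.cos θ • z.1 + -Real.sin θ • z.2)) θ := by
  have h1 : HasDerivAt (fun θ : ℝ => Real.cos θ • z.1 + Real.sin θ • z.2)
      (-Real.sin θ • z.1 + Real.cos θ • z.2) θ :=
    ((Real.hasDerivAt_cos θ).smul_const z.1).add ((Real.hasDerivAt_sin θ).smul_const z.2)
  have h2 : HasDerivAt (fun θ : ℝ => -Real.sin θ • z.1 + Real.cos θ • z.2)
      (-Real.cos θ • z.1 + -Real.sin θ • z.2) θ :=
    ((Real.hasDerivAt_sin θ).neg.smul_const z.1).add ((Real.hasDerivAt_cos θ).smul_const z.2)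
  exact ((hf _).hasFDerivAt.comp_hasDerivAt θ h1).mul (l.hasFDerivAt.comp_hasDerivAt θ h2)

theorem norm_smul_add_smul_le (z : X × X) {a b : ℝ} (ha : |a| ≤ 1) (hb : |b| ≤ 1) :
    ‖a • z.1 + b • z.2‖ ≤ ‖z.1‖ + ‖z.2‖ := by
  refine (norm_add_le _ _).trans (add_le_add ?_ ?_) <;> rw [norm_smul, Real.norm_eq_abs]
  · exact mul_le_of_le_one_left (norm_nonneg _) ha
  · exact mul_le_of_le_one_left (norm_nonneg _) hb

end

variable {X : Type*} [NormedAddCommGroup X] [NormedSpace ℝ X] [CompleteSpace X]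
  [SecondCountableTopology X] [MeasurableSpace X] [BorelSpace X]
  (μ : Measure X) [IsGaussian μ]

/-- A continuous linear functional as an element of the Cameron–Martin space. -/
def dualToCM (l : StrongDual ℝ X) : CameronMartin μ :=
  ⟨StrongDual.toLp μ 2 l, Submodule.le_topologicalClosure _ ⟨l, rfl⟩⟩

theorem covOp_dualToCM (l : StrongDual ℝ X) : covOp μ (dualToCM μ l) = ∫ y, l y • y ∂μ := by
  refine integral_congr_ae ?_
  have : ((dualToCM μ l : CameronMartin μ) : Lp ℝ 2 μ) =ᵐ[μ] l := by
    change StrongDual.toLp μ 2 l =ᵐ[μ] l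
    rw [StrongDual.toLp_apply IsGaussian.memLp_two_id]
    exact (IsGaussian.memLp_two_id.continuousLinearMap_comp l).coeFn_toLp (μ := μ)
  filter_upwards [this] with x hx
  rw [hx]

theorem integrable_dual_smul (l : StrongDual ℝ X) : Integrable (fun y => l y • y) μ :=
  memLp_one_iff_integrable.1 ((IsGaussian.memLp_two_id (μ := μ)).smul
    (IsGaussian.memLp_two_id.continuousLinearMap_comp l) (p := 2) (r := 1))

theorem memLp_dual (l : StrongDual ℝ X) {q : ℝ≥0∞} (hq : q ≠ ⊤) : MemLp l q μ :=
  (IsGaussian.memLp_id μ q hq).continuousLinearMap_comp l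

theorem integrable_dual (l : StrongDual ℝ X) : Integrable l μ :=
  memLp_one_iff_integrable.1 (memLp_dual μ l ENNReal.one_ne_top)

theorem memLp_norm_add_norm_prod (q : ℝ≥0∞) (hq : q ≠ ⊤) :
    MemLp (fun z : X × X => ‖z.1‖ + ‖z.2‖) q (μ.prod μ) :=
  ((IsGaussian.memLp_id μ q hq).norm.comp_fst μ).add ((IsGaussian.memLp_id μ q hq).norm.comp_snd μ)

variable {μ} {f : X → ℝ}

/-- For centered `μ` the product `μ ⊗ μ` is invariant under rotations, so the angle may be taken to
be `0`; there the variables separate and `l` has mean zero. -/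
theorem integral_rotation_integrand (hμ : IsCentered μ) (hf : IsBoundedC1 f) (l : StrongDual ℝ X)
    (θ : ℝ) :
    ∫ z : X × X, f (Real.cos θ • z.1 + Real.sin θ • z.2) *
      l (-Real.sin θ • z.1 + Real.cos θ • z.2) ∂μ.prod μ = 0 := by
  have h0 : ∫ z : X × X, f z.1 * l z.2 ∂μ.prod μ = 0 := by
    rw [integral_prod_mul f l, hμ l, mul_zero]
  have hm : AEStronglyMeasurable (fun z : X × X => f z.1 * l z.2)
      ((μ.prod μ).map (ContinuousLinearMap.rotation θ)) :=
    ((hf.continuous.comp continuous_fst).mul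
      (l.continuous.comp continuous_snd)).aestronglyMeasurable
  rw [← IsGaussian.map_rotation_eq_self_of_forall_strongDual_eq_zero hμ θ,
    integral_map (by fun_prop) hm] at h0
  simpa only [ContinuousLinearMap.rotation_apply] using h0

/-- Gaussian integration by parts in the direction of a continuous linear functional. -/
theorem integral_fderiv_covOp (hμ : IsCentered μ) (hf : IsBoundedC1 f) (l : StrongDual ℝ X) :
    ∫ x, fderiv ℝ f x (covOp μ (dualToCM μ l)) ∂μ = ∫ x, f x * l x ∂μ := by
  obtain ⟨A, hA⟩ := hf.bounded
  obtain ⟨A', hA'⟩ := hf.bounded_fderiv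
  have hA0 : 0 ≤ A := (norm_nonneg _).trans (hA 0)
  have hA'0 : 0 ≤ A' := (norm_nonneg _).trans (hA' 0)
  have hfc := hf.continuous
  have hf'c := hf.continuous_fderiv
  -- Gaussian measures have norm moments of all orders; the second moment dominates the term in
  -- which both the derivative of `f` and `l` grow linearly.
  have hN2 : Integrable (fun z : X × X => (‖z.1‖ + ‖z.2‖) ^ 2) (μ.prod μ) :=
    (memLp_norm_add_norm_prod μ 2 (by simp)).integrable_sq
  have hN1 : Integrable (fun z : X × X => ‖z.1‖ + ‖z.2‖) (μ.prod μ) :=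
    memLp_one_iff_integrable.1 (memLp_norm_add_norm_prod μ 1 (by simp))
  have hcont : ∀ θ : ℝ, Continuous (fun z : X × X =>
      f (Real.cos θ • z.1 + Real.sin θ • z.2) * l (-Real.sin θ • z.1 + Real.cos θ • z.2)) :=
    fun θ => by fun_prop
  have key := hasDerivAt_integral_of_dominated_loc_of_deriv_le (𝕜 := ℝ) (μ := μ.prod μ)
    (s := Set.univ) (x₀ := (0 : ℝ))
    (F := fun θ z => f (Real.cos θ • z.1 + Real.sin θ • z.2) *
        l (-Real.sin θ • z.1 + Real.cos θ • z.2))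
    (F' := fun θ z => fderiv ℝ f (Real.cos θ • z.1 + Real.sin θ • z.2)
          (-Real.sin θ • z.1 + Real.cos θ • z.2) * l (-Real.sin θ • z.1 + Real.cos θ • z.2) +
        f (Real.cos θ • z.1 + Real.sin θ • z.2) * l (-Real.cos θ • z.1 + -Real.sin θ • z.2))
    (bound := fun z => A' * ‖l‖ * (‖z.1‖ + ‖z.2‖) ^ 2 + A * ‖l‖ * (‖z.1‖ + ‖z.2‖))
    univ_mem (Eventually.of_forall fun θ => (hcont θ).aestronglyMeasurable) ?_ ?_ ?_
    ((hN2.const_mul _).add (hN1.const_mul _))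
    (ae_of_all _ fun z θ _ => hasDerivAt_rotation_integrand hf.differentiable l z θ)
  -- The integral is `0` for every angle, so its derivative at `θ = 0`, namely `∫ (f'(x)[y] l(y) -
  -- f(x) l(x))`, vanishes.
  · have h1 := key.2.unique ((hasDerivAt_const (0 : ℝ) (0 : ℝ)).congr_of_eventuallyEq
      (Eventually.of_forall fun θ => integral_rotation_integrand hμ hf l θ))
    simp only [Real.cos_zero, Real.sin_zero, one_smul, zero_smul, add_zero, neg_zero, zero_add,
      neg_smul, map_neg, mul_neg] at h1
    have hi1 : Integrable (fun z : X × X => fderiv ℝ f z.1 z.2 * l z.2) (μ.prod μ) := by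
      refine (hN2.const_mul (A' * ‖l‖)).mono' (Continuous.aestronglyMeasurable (by fun_prop))
        (ae_of_all _ fun z => ?_)
      have hz : ‖z.2‖ ≤ ‖z.1‖ + ‖z.2‖ := le_add_of_nonneg_left (norm_nonneg _)
      rw [norm_mul]
      calc _ ≤ (A' * (‖z.1‖ + ‖z.2‖)) * (‖l‖ * (‖z.1‖ + ‖z.2‖)) := by
            gcongr
            · exact ((fderiv ℝ f z.1).le_opNorm _).trans (by gcongr; exact hA' _)
            · exact (l.le_opNorm _).trans (by gcongr)
        _ = _ := by ring
    have hi2 : Integrable (fun x => f x * l x) μ :=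
      (integrable_dual μ l).bdd_mul hfc.aestronglyMeasurable (ae_of_all _ hA)
    have hi2' : Integrable (fun z : X × X => f z.1 * l z.1) (μ.prod μ) := hi2.comp_fst μ
    -- Integrating over `y` first, `f'(x)` passes outside and leaves `∫ l(y) y dμ(y) = R_μ l`.
    have e1 : ∫ z : X × X, fderiv ℝ f z.1 z.2 * l z.2 ∂μ.prod μ =
        ∫ x, fderiv ℝ f x (covOp μ (dualToCM μ l)) ∂μ := by
      rw [integral_prod _ hi1]
      refine integral_congr_ae (ae_of_all _ fun x => ?_)
      simp only [covOp_dualToCM]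
      rw [← ContinuousLinearMap.integral_comp_comm _ (integrable_dual_smul μ l)]
      simp [mul_comm]
    have e2 : ∫ z : X × X, f z.1 * l z.1 ∂μ.prod μ = ∫ x, f x * l x ∂μ := by
      rw [integral_fun_fst (fun x => f x * l x)]
      simp
    rw [← e1, ← e2, ← sub_eq_zero, ← integral_sub hi1 hi2', ← h1]
    simp only [sub_eq_add_neg]
  · refine (hN1.const_mul (A * ‖l‖)).mono' (hcont 0).aestronglyMeasurable
      (ae_of_all _ fun z => ?_)
    rw [norm_mul, mul_assoc]
    gcongr
    · exact hA _
    · refine (l.le_opNorm _).trans ?_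
      gcongr
      exact norm_smul_add_smul_le z (by simp) (by simp)
  · exact Continuous.aestronglyMeasurable (by fun_prop)
  · refine ae_of_all _ fun z θ _ => ?_
    have hc : |Real.cos θ| ≤ 1 := Real.abs_cos_le_one θ
    have hs : |Real.sin θ| ≤ 1 := Real.abs_sin_le_one θ
    have hs' : |-Real.sin θ| ≤ 1 := by rwa [abs_neg]
    have hc' : |-Real.cos θ| ≤ 1 := by rwa [abs_neg]
    refine (norm_add_le _ _).trans (add_le_add ?_ ?_) <;> rw [norm_mul]
    · calc _ ≤ (A' * (‖z.1‖ + ‖z.2‖)) * (‖l‖ * (‖z.1‖ + ‖z.2‖)) := by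
            gcongr
            · refine ((fderiv ℝ f _).le_opNorm _).trans ?_
              gcongr
              · exact hA' _
              · exact norm_smul_add_smul_le z hs' hc
            · refine (l.le_opNorm _).trans ?_
              gcongr
              exact norm_smul_add_smul_le z hs' hc
        _ = _ := by ring
    · rw [mul_assoc]
      gcongr
      · exact hA _
      · refine (l.le_opNorm _).trans ?_
        gcongr
        exact norm_smul_add_smul_le z hc' hs'

end GaussianIntegrationByParts

/-! ### Integration by parts for compositions with Sobolev functions. -/

section SobolevIntegrationByParts

variable {X : Type*} [NormedAddCommGroup X] [NormedSpace ℝ X] [CompleteSpace X]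
  [SecondCountableTopology X] [MeasurableSpace X] [BorelSpace X]
  {μ : Measure X} [IsGaussian μ]

/-- Gaussian integration by parts for the product `G ψ(f)`. All terms are kept under one integral so
that limits in `f` and `ψ` can be taken by dominated convergence. -/
theorem integral_mul_comp_of_isBoundedC1 (hμ : IsCentered μ) {f G : X → ℝ} {ψ : ℝ → ℝ}
    (hf : IsBoundedC1 f) (hψ : IsBoundedC1 ψ) (hG : IsBoundedC1 G) (l : StrongDual ℝ X) :
    ∫ x, (G x * (deriv ψ (f x) * inner ℝ (gradH μ f x) (dualToCM μ l)) +
      ψ (f x) * fderiv ℝ G x (covOp μ (dualToCM μ l)) - G x * ψ (f x) * l x) ∂μ = 0 := by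
  have hψf := hψ.comp hf
  have hGψ := hG.mul hψf
  have h1 := integral_fderiv_covOp hμ hGψ l
  have hi1 : Integrable (fun x => fderiv ℝ (fun y => G y * ψ (f y)) x
      (covOp μ (dualToCM μ l))) μ := by
    obtain ⟨C, hC⟩ := hGψ.bounded_fderiv
    refine Integrable.of_bound (C := C * ‖covOp μ (dualToCM μ l)‖)
      (hGψ.continuous_fderiv.clm_apply continuous_const).aestronglyMeasurable
      (ae_of_all _ fun x => ?_)
    exact (ContinuousLinearMap.le_opNorm _ _).trans (by gcongr; exact hC x)
  have hi2 : Integrable (fun x => G x * ψ (f x) * l x) μ := by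
    obtain ⟨C, hC⟩ := hGψ.bounded
    exact (integrable_dual μ l).bdd_mul hGψ.continuous.aestronglyMeasurable (ae_of_all _ hC)
  rw [← sub_eq_zero, ← integral_sub hi1 hi2] at h1
  rw [← h1]
  refine integral_congr_ae (ae_of_all _ fun x => ?_)
  have hd : fderiv ℝ (fun y => ψ (f y)) x (covOp μ (dualToCM μ l)) =
      deriv ψ (f x) * inner ℝ (gradH μ f x) (dualToCM μ l) := by
    have := fderiv_comp x (hψ.differentiable (f x)) (hf.differentiable x)
    rw [Function.comp_def] at this
    rw [this, inner_gradH μ hf.differentiable, ContinuousLinearMap.comp_apply,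
      fderiv_eq_smul_deriv, smul_eq_mul, mul_comm]
  simp only [hG.fderiv_mul_apply hψf, hd]

theorem tendsto_integral_norm_of_tendsto_eLpNorm {E : Type*} [NormedAddCommGroup E]
    {α : Type*} [MeasurableSpace α] {P : Measure α} [IsProbabilityMeasure P] {q : ℝ≥0∞} (hq : 1 ≤ q) {u : ℕ → α → E}
    (hu : ∀ k, MemLp (u k) q P) (h : Tendsto (fun k => eLpNorm (u k) q P) atTop (𝓝 0)) :
    Tendsto (fun k => ∫ x, ‖u k x‖ ∂P) atTop (𝓝 0) := by
  have h1 : Tendsto (fun k => eLpNorm (u k) 1 P) atTop (𝓝 0) :=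
    tendsto_of_tendsto_of_tendsto_of_le_of_le tendsto_const_nhds h (fun _ => zero_le)
      (fun k => eLpNorm_le_eLpNorm_of_exponent_le hq (hu k).aestronglyMeasurable)
  have h2 := (ENNReal.tendsto_toReal ENNReal.zero_ne_top).comp h1
  rw [ENNReal.toReal_zero] at h2
  refine h2.congr fun k => ?_
  rw [Function.comp_apply, eLpNorm_one_eq_lintegral_enorm,
    integral_norm_eq_lintegral_enorm (hu k).aestronglyMeasurable]

/-- Integration by parts for `G ψ(v)`, where `v` belongs to a Gaussian Sobolev space with gradient
`Φ`, and `G`, `ψ` are bounded `C¹` functions with bounded derivatives. -/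
theorem integral_mul_comp_of_sobolev (hμ : IsCentered μ) {q : ℝ≥0∞} (hq : 1 ≤ q)
    {v : X → ℝ} (hv : MemLp v q μ) {Φ : X → CameronMartin μ} (hΦ : MemLp Φ q μ)
    {F : ℕ → X → ℝ} (hF : ∀ k, IsBoundedC1 (F k))
    (hFv : Tendsto (fun k => eLpNorm (fun x => F k x - v x) q μ) atTop (𝓝 0))
    (hFΦ : Tendsto (fun k => eLpNorm (fun x => gradH μ (F k) x - Φ x) q μ) atTop (𝓝 0))
    {ψ : ℝ → ℝ} (hψ : IsBoundedC1 ψ) {G : X → ℝ} (hG : IsBoundedC1 G) (l : StrongDual ℝ X) :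
    ∫ x, (G x * (deriv ψ (v x) * inner ℝ (Φ x) (dualToCM μ l)) +
      ψ (v x) * fderiv ℝ G x (covOp μ (dualToCM μ l)) - G x * ψ (v x) * l x) ∂μ = 0 := by
  set h := dualToCM μ l
  obtain ⟨ns, hns, hae⟩ := (tendstoInMeasure_of_tendsto_eLpNorm (zero_lt_one.trans_le hq).ne'
    (fun k => (hF k).continuous.aestronglyMeasurable) hv.aestronglyMeasurable
    hFv).exists_seq_tendsto_ae
  have hgrad : ∀ k, MemLp (gradH μ (F k)) q μ := fun k => (hF k).memLp_gradH μ μ q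
  have hL1 := tendsto_integral_norm_of_tendsto_eLpNorm hq (fun k => (hgrad (ns k)).sub hΦ)
    (hFΦ.comp hns.tendsto_atTop)
  obtain ⟨A, hA⟩ := hG.bounded
  obtain ⟨A', hA'⟩ := hG.bounded_fderiv
  obtain ⟨M, hM⟩ := hψ.bounded
  obtain ⟨M', hM'⟩ := hψ.bounded_fderiv
  simp only [← norm_deriv_eq_norm_fderiv] at hM'
  have hA0 : 0 ≤ A := (norm_nonneg _).trans (hA 0)
  have hA'0 : 0 ≤ A' := (norm_nonneg _).trans (hA' 0)
  have hM0 : 0 ≤ M := (norm_nonneg _).trans (hM 0)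
  have hM'0 : 0 ≤ M' := (norm_nonneg _).trans (hM' 0)
  have hψ' : Continuous (deriv ψ) := hψ.contDiff.continuous_deriv le_rfl
  have hΦ1 : Integrable Φ μ := hΦ.integrable hq
  have hΦh : AEStronglyMeasurable (fun x => inner ℝ (Φ x) h) μ :=
    hΦ1.aestronglyMeasurable.inner aestronglyMeasurable_const
  have hGc := hG.continuous
  have hG' : Continuous (fun x => fderiv ℝ G x (covOp μ h)) :=
    hG.continuous_fderiv.clm_apply continuous_const
  -- A hybrid integrand: `F_k` stands inside `ψ` and `ψ'`, but the gradient is already the limit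
  -- `Φ`. It is therefore dominated by a fixed function, and a.e. convergence of `F_k` along the
  -- subsequence suffices.
  let B : ℕ → X → ℝ := fun k x => G x * (deriv ψ (F (ns k) x) * inner ℝ (Φ x) h) +
      ψ (F (ns k) x) * fderiv ℝ G x (covOp μ h) - G x * ψ (F (ns k) x) * l x
  let bound : X → ℝ := fun x => A * (M' * (‖Φ x‖ * ‖h‖)) + M * (A' * ‖covOp μ h‖) +
      A * M * ‖l x‖
  have hbi : Integrable bound μ :=
    ((((hΦ1.norm.mul_const _).const_mul _).const_mul _).add (integrable_const _)).add
      ((integrable_dual μ l).norm.const_mul _)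
  have hBm : ∀ k, AEStronglyMeasurable (B k) μ := fun k =>
    ((hGc.aestronglyMeasurable.mul
      ((hψ'.comp (hF (ns k)).continuous).aestronglyMeasurable.mul hΦh)).add
      ((hψ.continuous.comp (hF (ns k)).continuous).mul hG').aestronglyMeasurable).sub
      ((hGc.mul (hψ.continuous.comp (hF (ns k)).continuous)).mul
        l.continuous).aestronglyMeasurable
  have hBb : ∀ k x, ‖B k x‖ ≤ bound x := fun k x => by
    refine (norm_sub_le _ _).trans (add_le_add ((norm_add_le _ _).trans (add_le_add ?_ ?_)) ?_)
    · rw [norm_mul, norm_mul]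
      gcongr
      · exact hA x
      · exact hM' _
      · exact norm_inner_le_norm _ _
    · rw [norm_mul]
      gcongr
      · exact hM _
      · exact (ContinuousLinearMap.le_opNorm _ _).trans (by gcongr; exact hA' x)
    · rw [norm_mul, norm_mul]
      gcongr
      · exact hA x
      · exact hM _
  have hlim := tendsto_integral_of_dominated_convergence bound hBm hbi
    (fun k => ae_of_all _ (hBb k)) (f := fun x => G x * (deriv ψ (v x) * inner ℝ (Φ x) h) +
      ψ (v x) * fderiv ℝ G x (covOp μ h) - G x * ψ (v x) * l x) (by
      filter_upwards [hae] with x hx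
      have h1 := (hψ'.tendsto (v x)).comp hx
      have h2 := (hψ.continuous.tendsto (v x)).comp hx
      exact (((h1.mul_const _).const_mul _).add (h2.mul_const _)).sub
        ((h2.const_mul _).mul_const _))
  -- The same integrals tend to `0`: by the exact formula for `F_k`, `∫ B k` is minus the error from
  -- replacing `∇_H F_k` by `Φ`, which is bounded by a multiple of their `L¹` distance.
  refine tendsto_nhds_unique hlim ?_
  refine squeeze_zero_norm (a := fun k => A * M' * ‖h‖ *
    ∫ x, ‖(gradH μ (F (ns k)) - Φ) x‖ ∂μ) (fun k => ?_) (by simpa using hL1.const_mul _)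
  have hBi : Integrable (B k) μ := hbi.mono' (hBm k) (ae_of_all _ (hBb k))
  have hgi : Integrable (gradH μ (F (ns k)) - Φ) μ := ((hgrad (ns k)).sub hΦ).integrable hq
  let a : X → ℝ := fun x =>
    G x * (deriv ψ (F (ns k) x) * inner ℝ ((gradH μ (F (ns k)) - Φ) x) h)
  have hab : ∀ x, ‖a x‖ ≤ A * M' * ‖h‖ * ‖(gradH μ (F (ns k)) - Φ) x‖ := fun x => by
    have : ‖a x‖ ≤ A * (M' * (‖(gradH μ (F (ns k)) - Φ) x‖ * ‖h‖)) := by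
      simp only [a]
      rw [norm_mul, norm_mul]
      gcongr
      · exact hA x
      · exact hM' _
      · exact norm_inner_le_norm _ _
    linarith
  have hai : Integrable a μ := (hgi.norm.const_mul _).mono'
    (hGc.aestronglyMeasurable.mul ((hψ'.comp (hF (ns k)).continuous).aestronglyMeasurable.mul
      (hgi.aestronglyMeasurable.inner aestronglyMeasurable_const))) (ae_of_all _ hab)
  have h0 := integral_mul_comp_of_isBoundedC1 hμ (hF (ns k)) hψ hG l
  have hsplit : ∫ x, B k x ∂μ = - ∫ x, a x ∂μ := by
    rw [eq_neg_iff_add_eq_zero, ← integral_add hBi hai, ← h0]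
    refine integral_congr_ae (ae_of_all _ fun x => ?_)
    simp only [B, a, Pi.sub_apply, inner_sub_left]
    ring
  rw [hsplit, norm_neg, ← integral_const_mul]
  exact norm_integral_le_of_norm_le (hgi.norm.const_mul _) (ae_of_all _ hab)

end SobolevIntegrationByParts

/-! ### Integrability with respect to `w μ`. -/

section WeightedMeasures

section Weighted

variable {X : Type*} [MeasurableSpace X] {μ : Measure X} {w : X → ℝ}

theorem isFiniteMeasure_weighted (hwi : Integrable w μ) : IsFiniteMeasure (weighted μ w) :=
  isFiniteMeasure_withDensity_ofReal hwi.2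

theorem weighted_absolutelyContinuous : weighted μ w ≪ μ :=
  withDensity_absolutelyContinuous _ _

variable {E : Type*} [NormedAddCommGroup E]

theorem integral_weighted [NormedSpace ℝ E] (hw : AEMeasurable w μ) (hw0 : ∀ᵐ x ∂μ, 0 < w x) (u : X → E) :
    ∫ x, u x ∂weighted μ w = ∫ x, w x • u x ∂μ := by
  rw [weighted, integral_withDensity_eq_integral_toReal_smul₀ hw.ennreal_ofReal (by simp)]
  refine integral_congr_ae ?_
  filter_upwards [hw0] with x hx
  rw [ENNReal.toReal_ofReal hx.le]

theorem integrable_weighted_iff [NormedSpace ℝ E] (hw : AEMeasurable w μ)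
    (hw0 : ∀ᵐ x ∂μ, 0 < w x) {u : X → E} :
    Integrable u (weighted μ w) ↔ Integrable (fun x => w x • u x) μ := by
  rw [weighted, integrable_withDensity_iff_integrable_smul₀' hw.ennreal_ofReal (by simp)]
  refine integrable_congr ?_
  filter_upwards [hw0] with x hx
  rw [ENNReal.toReal_ofReal hx.le]

/-- Hölder's inequality: `L^t(μ)` embeds into `L^{t/s'}(w μ)` if `w ∈ L^s(μ)`. -/
theorem memLp_weighted {s s' t : ℝ} (hs : s.HolderConjugate s') (ht : s' < t)
    (hw0 : ∀ᵐ x ∂μ, 0 < w x) (hws : MemLp w (ENNReal.ofReal s) μ) {u : X → E}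
    (hu : MemLp u (ENNReal.ofReal t) μ) : MemLp u (ENNReal.ofReal (t / s')) (weighted μ w) := by
  have hs'0 : 0 < s' := hs.symm.pos
  have ht0 : 0 < t := hs'0.trans ht
  have hr0 : 0 < t / s' := div_pos ht0 hs'0
  have := hs.ennrealOfReal
  rw [← integrable_norm_rpow_iff (hu.1.mono_ac weighted_absolutelyContinuous)
    (ENNReal.ofReal_pos.2 hr0).ne' ENNReal.ofReal_ne_top,
    integrable_weighted_iff hws.1.aemeasurable hw0]
  -- Since `t / (t/s') = s'`, the function `|u|^{t/s'}` lies in `L^{s'}(μ)`, dual to `w ∈ L^s(μ)`.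
  have h1 := hu.norm_rpow_div (ENNReal.ofReal (t / s'))
  rw [← ENNReal.ofReal_div_of_pos hr0, div_div_cancel₀ ht0.ne'] at h1
  exact hws.integrable_mul h1

end Weighted

/-! ### Bounded `C¹` functions determine integrable functions. -/

section Density

/-- `ENNReal.ofReal` cuts off at zero, so the two densities are the positive and negative parts of
`u`. -/
theorem integral_withDensity_sub_withDensity_neg {X : Type*} [TopologicalSpace X]
    [MeasurableSpace X] [BorelSpace X] {ν : Measure X} {u : X → ℝ} (hu : Integrable u ν)
    {e : X → ℂ} (he : Continuous e) (he1 : ∀ x, ‖e x‖ ≤ 1) :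
    ∫ x, e x ∂ν.withDensity (fun x => ENNReal.ofReal (u x)) -
      ∫ x, e x ∂ν.withDensity (fun x => ENNReal.ofReal (-u x)) = ∫ x, u x • e x ∂ν := by
  have hm := hu.1.aemeasurable
  have hm' : AEMeasurable (fun x => -u x) ν := hm.neg
  have hi : ∀ {v : X → ℝ}, Integrable v ν →
      Integrable (fun x => (ENNReal.ofReal (v x)).toReal • e x) ν := fun {v} hv => by
    refine hv.norm.mono' (hv.1.aemeasurable.ennreal_ofReal.ennreal_toReal.aestronglyMeasurable.smul
      he.aestronglyMeasurable) (ae_of_all _ fun x => ?_)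
    rw [norm_smul, ENNReal.toReal_ofReal', Real.norm_eq_abs, Real.norm_eq_abs]
    calc _ ≤ |max (v x) 0| * 1 := by gcongr; exact he1 x
      _ ≤ |v x| := by
        rw [mul_one, abs_of_nonneg (le_max_right _ _)]
        exact max_le (le_abs_self _) (abs_nonneg _)
  rw [integral_withDensity_eq_integral_toReal_smul₀ hm.ennreal_ofReal (by simp),
    integral_withDensity_eq_integral_toReal_smul₀ hm'.ennreal_ofReal (by simp),
    ← integral_sub (hi hu) (hi (v := fun x => -u x) hu.neg)]
  refine integral_congr_ae (ae_of_all _ fun x => ?_)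
  simp only [ENNReal.toReal_ofReal', ← sub_smul]
  congr 1
  rcases le_total (u x) 0 with h | h
  · rw [max_eq_right h, max_eq_left (neg_nonneg.2 h), zero_sub, neg_neg]
  · rw [max_eq_left h, max_eq_right (neg_nonpos.2 h), sub_zero]

variable {X : Type*} [NormedAddCommGroup X] [NormedSpace ℝ X] [CompleteSpace X]
  [SecondCountableTopology X] [MeasurableSpace X] [BorelSpace X]

/-- An integrable function which is orthogonal to all bounded `C¹` functions vanishes. -/
theorem ae_eq_zero_of_forall_integral_isBoundedC1_mul {ν : Measure X} {u : X → ℝ}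
    (hu : Integrable u ν) (h : ∀ g : X → ℝ, IsBoundedC1 g → ∫ x, g x * u x ∂ν = 0) :
    u =ᵐ[ν] 0 := by
  have hm := hu.1.aemeasurable
  have hm' : AEMeasurable (fun x => -u x) ν := hm.neg
  have := isFiniteMeasure_withDensity_ofReal hu.2
  have := isFiniteMeasure_withDensity_ofReal (f := fun x => -u x) hu.neg.2
  -- The real and imaginary parts of a character are `cos ∘ L` and `sin ∘ L`, which are admissible
  -- test functions.
  have hchar : charFunDual (ν.withDensity fun x => ENNReal.ofReal (u x)) =
      charFunDual (ν.withDensity fun x => ENNReal.ofReal (-u x)) := by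
    ext L
    rw [charFunDual_apply, charFunDual_apply, ← sub_eq_zero,
      integral_withDensity_sub_withDensity_neg hu (by fun_prop)
        (fun x => (Complex.norm_exp_ofReal_mul_I _).le)]
    have hc := isBoundedC1_cos.comp_continuousLinearMap L
    have hsn := isBoundedC1_sin.comp_continuousLinearMap L
    have hci : Integrable (fun x => Real.cos (L x) * u x) ν :=
      hu.bdd_mul hc.continuous.aestronglyMeasurable (ae_of_all _ fun x => Real.abs_cos_le_one _)
    have hsi : Integrable (fun x => Real.sin (L x) * u x) ν :=
      hu.bdd_mul hsn.continuous.aestronglyMeasurable (ae_of_all _ fun x => Real.abs_sin_le_one _)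
    have heq : ∀ x, u x • Complex.exp (L x * Complex.I) =
        ((Real.cos (L x) * u x : ℝ) : ℂ) + ((Real.sin (L x) * u x : ℝ) : ℂ) * Complex.I := by
      intro x
      rw [Complex.exp_mul_I, Complex.real_smul]
      push_cast
      ring
    simp only [heq]
    rw [integral_add hci.ofReal (hsi.ofReal.mul_const _), integral_mul_const,
      integral_complex_ofReal, integral_complex_ofReal, h _ hc, h _ hsn]
    simp
  -- The characteristic functional determines a finite measure, so the positive and negative parts
  -- of `u` agree a.e.; one of them is always zero.
  have heq := (withDensity_eq_iff hm.ennreal_ofReal hm'.ennreal_ofReal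
    hu.lintegral_lt_top.ne).1 (Measure.ext_of_charFunDual hchar)
  filter_upwards [heq] with x hx
  rcases le_total (u x) 0 with h0 | h0
  · rw [ENNReal.ofReal_of_nonpos h0] at hx
    exact le_antisymm h0 (neg_nonpos.1 (ENNReal.ofReal_eq_zero.1 hx.symm))
  · rw [ENNReal.ofReal_of_nonpos (neg_nonpos.2 h0)] at hx
    exact le_antisymm (ENNReal.ofReal_eq_zero.1 hx) h0

end Density

/-! ### Bounded approximations of the exponential. -/

section Truncation

/-- The bounded smooth function `y ↦ e^y / (1 + ε e^y)`, which approximates `exp` as `ε → 0`. -/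
def truncExp (ε y : ℝ) : ℝ := Real.exp y / (1 + ε * Real.exp y)

theorem hasDerivAt_truncExp {ε : ℝ} (hε : 0 < ε) (y : ℝ) :
    HasDerivAt (truncExp ε) (Real.exp y / (1 + ε * Real.exp y) ^ 2) y := by
  have h0 : 1 + ε * Real.exp y ≠ 0 := by positivity
  convert! (Real.hasDerivAt_exp y).div
    (((Real.hasDerivAt_exp y).const_mul ε).const_add 1) h0 using 1
  ring

theorem norm_truncExp_le_exp {ε : ℝ} (hε : 0 < ε) (y : ℝ) : ‖truncExp ε y‖ ≤ Real.exp y := by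
  rw [truncExp, Real.norm_of_nonneg (by positivity)]
  exact div_le_self (Real.exp_pos y).le (le_add_of_nonneg_right (by positivity))

theorem norm_truncExp_le {ε : ℝ} (hε : 0 < ε) (y : ℝ) : ‖truncExp ε y‖ ≤ ε⁻¹ := by
  rw [truncExp, Real.norm_of_nonneg (by positivity), div_le_iff₀ (by positivity), mul_add,
    inv_mul_cancel_left₀ hε.ne']
  exact le_add_of_nonneg_left (by positivity)

/-- The derivative only has a further factor `1 + ε e^y ≥ 1` in its denominator. Hence at `y = log
w` both the function and its derivative are at most `w`, uniformly in `ε`. -/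
theorem norm_deriv_truncExp_le {ε : ℝ} (hε : 0 < ε) (y : ℝ) :
    ‖deriv (truncExp ε) y‖ ≤ ‖truncExp ε y‖ := by
  have h1 : 1 ≤ 1 + ε * Real.exp y := le_add_of_nonneg_right (by positivity)
  rw [(hasDerivAt_truncExp hε y).deriv, truncExp, Real.norm_of_nonneg (by positivity),
    Real.norm_of_nonneg (by positivity)]
  exact div_le_div_of_nonneg_left (Real.exp_pos y).le (by positivity) (le_self_pow₀ h1 two_ne_zero)

theorem isBoundedC1_truncExp {ε : ℝ} (hε : 0 < ε) : IsBoundedC1 (truncExp ε) := by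
  refine .of_deriv (hasDerivAt_truncExp hε) (A := ε⁻¹) (A' := ε⁻¹) ?_ (norm_truncExp_le hε) ?_
  · refine Real.continuous_exp.div (by fun_prop) fun y => ?_
    positivity
  · intro y
    rw [← (hasDerivAt_truncExp hε y).deriv]
    exact (norm_deriv_truncExp_le hε y).trans (norm_truncExp_le hε y)

theorem tendsto_truncExp (y : ℝ) :
    Tendsto (fun n : ℕ => truncExp (1 / ((n : ℝ) + 1)) y) atTop (𝓝 (Real.exp y)) := by
  have h : Tendsto (fun n : ℕ => 1 + 1 / ((n : ℝ) + 1) * Real.exp y) atTop (𝓝 1) := by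
    simpa using (tendsto_one_div_add_atTop_nhds_zero_nat.mul_const (Real.exp y)).const_add 1
  have h2 := (tendsto_const_nhds (x := Real.exp y)).div h one_ne_zero
  rwa [div_one] at h2

theorem tendsto_deriv_truncExp (y : ℝ) :
    Tendsto (fun n : ℕ => deriv (truncExp (1 / ((n : ℝ) + 1))) y) atTop (𝓝 (Real.exp y)) := by
  have h : Tendsto (fun n : ℕ => (1 + 1 / ((n : ℝ) + 1) * Real.exp y) ^ 2) atTop (𝓝 1) := by
    simpa using
      ((tendsto_one_div_add_atTop_nhds_zero_nat.mul_const (Real.exp y)).const_add 1).pow 2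
  have h2 := (tendsto_const_nhds (x := Real.exp y)).div h one_ne_zero
  rw [div_one] at h2
  refine h2.congr fun n => ?_
  rw [(hasDerivAt_truncExp Nat.one_div_pos_of_nat y).deriv]
  rfl

end Truncation

end WeightedMeasures

/-! ### Integration by parts for `w μ`, and closability. -/

section Closability

theorem continuous_lpPairing_left {α E F G : Type*} [MeasurableSpace α] {ν : Measure α}
    {p q : ℝ≥0∞} [Fact (1 ≤ p)] [Fact (1 ≤ q)] [p.HolderConjugate q] [NormedAddCommGroup E]
    [NormedSpace ℝ E] [NormedAddCommGroup F] [NormedSpace ℝ F] [NormedAddCommGroup G]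
    [NormedSpace ℝ G] [CompleteSpace G] (B : E →L[ℝ] F →L[ℝ] G) (k : Lp F q ν) :
    Continuous fun y : Lp E p ν => B.lpPairing ν p q y k :=
  ((B.lpPairing ν p q).flip k).continuous

section

variable {X : Type*} [NormedAddCommGroup X] [NormedSpace ℝ X] [MeasurableSpace X] [BorelSpace X]
  {μ : Measure X}

/-- Each `g ∈ H` is the limit of a sequence from `X*`, so only countably many null sets are
discarded for it. The essentially separable range of `Θ` then upgrades vanishing against each fixed
`g` to vanishing a.e. -/
theorem ae_eq_zero_of_forall_inner_dualToCM {ν : Measure X} {Θ : X → CameronMartin μ}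
    (hΘ : AEStronglyMeasurable Θ ν)
    (h : ∀ l : StrongDual ℝ X, (fun x => inner ℝ (Θ x) (dualToCM μ l)) =ᵐ[ν] 0) : Θ =ᵐ[ν] 0 := by
  have hall : ∀ g : CameronMartin μ, (fun x => inner ℝ (Θ x) g) =ᵐ[ν] 0 := fun g => by
    obtain ⟨y, hy, hyg⟩ := mem_closure_iff_seq_limit.1 g.2
    choose l hl using hy
    have hlg : Tendsto (fun n => dualToCM μ (l n)) atTop (𝓝 g) := by
      rw [tendsto_subtype_rng]
      exact hyg.congr fun n => (hl n).symm
    filter_upwards [ae_all_iff.2 fun n => h (l n)] with x hx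
    refine tendsto_nhds_unique ((tendsto_const_nhds (x := Θ x)).inner hlg) ?_
    simp only [hx]
    exact tendsto_const_nhds
  obtain ⟨S, hS, hΘS⟩ := hΘ.isSeparable_ae_range
  refine ae_eq_zero_of_forall_dual_of_isSeparable ℝ hS (fun c => ?_) hΘS
  filter_upwards [hall ((InnerProductSpace.toDual ℝ (CameronMartin μ)).symm c)] with x hx
  rw [real_inner_comm, InnerProductSpace.toDual_symm_apply] at hx
  exact hx

end

variable {X : Type*} [NormedAddCommGroup X] [NormedSpace ℝ X] [CompleteSpace X]
  [SecondCountableTopology X] [MeasurableSpace X] [BorelSpace X]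
  {μ : Measure X} [IsGaussian μ] {w : X → ℝ}

/-- Integration by parts with respect to `ν = w μ`, where `Φ` is the gradient of `log w`. -/
theorem integral_fderiv_weighted (hμ : IsCentered μ) {q : ℝ≥0∞} (hq : 1 ≤ q)
    (hw0 : ∀ᵐ x ∂μ, 0 < w x) (hwi : Integrable w μ)
    (hlog : MemLp (fun x => Real.log (w x)) q μ) {Φ : X → CameronMartin μ} (hΦ : MemLp Φ q μ)
    {F : ℕ → X → ℝ} (hF : ∀ k, IsBoundedC1 (F k))
    (hFv : Tendsto (fun k => eLpNorm (fun x => F k x - Real.log (w x)) q μ) atTop (𝓝 0))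
    (hFΦ : Tendsto (fun k => eLpNorm (fun x => gradH μ (F k) x - Φ x) q μ) atTop (𝓝 0))
    (hΦν : Integrable Φ (weighted μ w)) {l : StrongDual ℝ X} (hlν : Integrable l (weighted μ w))
    {G : X → ℝ} (hG : IsBoundedC1 G) :
    ∫ x, (fderiv ℝ G x (covOp μ (dualToCM μ l)) -
      G x * (l x - inner ℝ (Φ x) (dualToCM μ l))) ∂weighted μ w = 0 := by
  have hwm := hwi.1.aemeasurable
  have := isFiniteMeasure_weighted hwi
  rw [integral_weighted hwm hw0]
  set h := dualToCM μ l
  obtain ⟨A, hA⟩ := hG.bounded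
  obtain ⟨A', hA'⟩ := hG.bounded_fderiv
  have hA0 : 0 ≤ A := (norm_nonneg _).trans (hA 0)
  have hGc := hG.continuous
  have hG' : Continuous (fun x => fderiv ℝ G x (covOp μ h)) :=
    hG.continuous_fderiv.clm_apply continuous_const
  have hΦh : AEStronglyMeasurable (fun x => inner ℝ (Φ x) h) μ :=
    hΦ.1.inner aestronglyMeasurable_const
  let ψ : ℕ → ℝ → ℝ := fun n => truncExp (1 / ((n : ℝ) + 1))
  have hψ : ∀ n, IsBoundedC1 (ψ n) := fun n => isBoundedC1_truncExp Nat.one_div_pos_of_nat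
  have hψ' : ∀ n, Continuous (deriv (ψ n)) := fun n => (hψ n).contDiff.continuous_deriv le_rfl
  let B : ℕ → X → ℝ := fun n x => G x * (deriv (ψ n) (Real.log (w x)) * inner ℝ (Φ x) h) +
      ψ n (Real.log (w x)) * fderiv ℝ G x (covOp μ h) - G x * ψ n (Real.log (w x)) * l x
  -- The truncations and their derivatives at `log w` are bounded by `w`, so the dominating function
  -- is `w` times a `ν`-integrable one.
  let bound : X → ℝ := fun x => w x • (A * (‖Φ x‖ * ‖h‖) + A' * ‖covOp μ h‖ + A * ‖l x‖)
  have hbi : Integrable bound μ := by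
    rw [← integrable_weighted_iff hwm hw0]
    exact (((hΦν.norm.mul_const _).const_mul _).add (integrable_const _)).add
      (hlν.norm.const_mul _)
  have hBm : ∀ n, AEStronglyMeasurable (B n) μ := fun n =>
    ((hGc.aestronglyMeasurable.mul
      (((hψ' n).comp_aestronglyMeasurable hlog.1).mul hΦh)).add
      (((hψ n).continuous.comp_aestronglyMeasurable hlog.1).mul hG'.aestronglyMeasurable)).sub
      ((hGc.aestronglyMeasurable.mul ((hψ n).continuous.comp_aestronglyMeasurable hlog.1)).mul
        l.continuous.aestronglyMeasurable)
  have hBb : ∀ n, ∀ᵐ x ∂μ, ‖B n x‖ ≤ bound x := fun n => by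
    filter_upwards [hw0] with x hx
    have h1 : ‖ψ n (Real.log (w x))‖ ≤ w x := by
      have := norm_truncExp_le_exp (ε := 1 / ((n : ℝ) + 1)) Nat.one_div_pos_of_nat
        (Real.log (w x))
      rwa [Real.exp_log hx] at this
    have h2 : ‖deriv (ψ n) (Real.log (w x))‖ ≤ w x :=
      (norm_deriv_truncExp_le Nat.one_div_pos_of_nat _).trans h1
    have e : bound x = A * (w x * (‖Φ x‖ * ‖h‖)) + w x * (A' * ‖covOp μ h‖) +
        A * w x * ‖l x‖ := by
      simp only [bound, smul_eq_mul]
      ring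
    rw [e]
    refine (norm_sub_le _ _).trans (add_le_add ((norm_add_le _ _).trans (add_le_add ?_ ?_)) ?_)
    · rw [norm_mul, norm_mul]
      gcongr
      · exact hA x
      · exact norm_inner_le_norm _ _
    · rw [norm_mul]
      gcongr
      exact (ContinuousLinearMap.le_opNorm _ _).trans (by gcongr; exact hA' x)
    · rw [norm_mul, norm_mul]
      gcongr
      exact hA x
  -- The truncations and their derivatives both converge to `exp`, so at `log w` every term acquires
  -- the same factor `w`.
  have hlim := tendsto_integral_of_dominated_convergence bound hBm hbi hBb
    (f := fun x => w x • (fderiv ℝ G x (covOp μ h) - G x * (l x - inner ℝ (Φ x) h))) (by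
      filter_upwards [hw0] with x hx
      have h1 := tendsto_deriv_truncExp (Real.log (w x))
      have h2 := tendsto_truncExp (Real.log (w x))
      rw [Real.exp_log hx] at h1 h2
      have h3 := (((h1.mul_const (inner ℝ (Φ x) h)).const_mul (G x)).add
        (h2.mul_const (fderiv ℝ G x (covOp μ h)))).sub ((h2.const_mul (G x)).mul_const (l x))
      convert! h3 using 2
      simp only [smul_eq_mul]
      ring)
  refine tendsto_nhds_unique hlim ?_
  have h0 : ∀ n, ∫ x, B n x ∂μ = 0 := fun n =>
    integral_mul_comp_of_sobolev hμ hq hlog hΦ hF hFv hFΦ (hψ n) hG l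
  simp only [h0]
  exact tendsto_const_nhds

variable (μ) in
/-- The graph in `L^p(ν) × L^p(ν; H)` of the gradient along `H` on smooth cylindrical functions. -/
def gradGraph (ν : Measure X) (p : ℝ≥0∞) [Fact (1 ≤ p)] :
    Submodule ℝ (Lp ℝ p ν × Lp (CameronMartin μ) p ν) where
  carrier := {z | ∃ f : X → ℝ, IsSmoothCylindrical f ∧ z.1 =ᵐ[ν] f ∧ z.2 =ᵐ[ν] gradH μ f}
  zero_mem' := ⟨fun _ => 0, IsSmoothCylindrical.zero, Lp.coeFn_zero _ _ _, by
    filter_upwards [Lp.coeFn_zero (CameronMartin μ) p ν] with x hx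
    rw [gradH_zero]
    exact hx⟩
  add_mem' := by
    rintro ⟨F₁, Φ₁⟩ ⟨F₂, Φ₂⟩ ⟨f, hf, h1, h2⟩ ⟨g, hg, h3, h4⟩
    refine ⟨fun x => f x + g x, hf.add hg, ?_, ?_⟩
    · filter_upwards [Lp.coeFn_add F₁ F₂, h1, h3] with x hx h1 h3
      exact hx.trans (congrArg₂ (· + ·) h1 h3)
    · filter_upwards [Lp.coeFn_add Φ₁ Φ₂, h2, h4] with x hx h2 h4
      rw [gradH_add μ hf.isBoundedC1.differentiable hg.isBoundedC1.differentiable]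
      exact hx.trans (congrArg₂ (· + ·) h2 h4)
  smul_mem' := by
    rintro c ⟨F₁, Φ₁⟩ ⟨f, hf, h1, h2⟩
    refine ⟨fun x => c • f x, hf.const_smul c, ?_, ?_⟩
    · filter_upwards [Lp.coeFn_smul c F₁, h1] with x hx h1
      exact hx.trans (congrArg (c • ·) h1)
    · filter_upwards [Lp.coeFn_smul c Φ₁, h2] with x hx h2
      rw [gradH_const_smul μ hf.isBoundedC1.differentiable]
      exact hx.trans (congrArg (c • ·) h2)

/-- If the measure `ν` admits integration by parts along `H`, with logarithmic derivatives
in the dual exponent, then the closure of the graph of the gradient is a graph. -/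
theorem snd_eq_zero_of_mem_closure_gradGraph {ν : Measure X} [IsFiniteMeasure ν]
    {p p' : ℝ≥0∞} [Fact (1 ≤ p)] [Fact (1 ≤ p')] [p.HolderConjugate p']
    (β : StrongDual ℝ X → X → ℝ) (hβ : ∀ l, MemLp (β l) p' ν)
    (hibp : ∀ l, ∀ G : X → ℝ, IsBoundedC1 G →
      ∫ x, (fderiv ℝ G x (covOp μ (dualToCM μ l)) - G x * β l x) ∂ν = 0)
    (z : Lp ℝ p ν × Lp (CameronMartin μ) p ν) (hz : z ∈ (gradGraph μ ν p).topologicalClosure)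
    (hz0 : z.1 = 0) : z.2 = 0 := by
  have key : ∀ (l : StrongDual ℝ X) (g : X → ℝ), IsBoundedC1 g →
      ∫ x, g x * inner ℝ (z.2 x) (dualToCM μ l) ∂ν = 0 := by
    intro l g hg
    set h := dualToCM μ l
    have hg' : Continuous (fun x => fderiv ℝ g x (covOp μ h)) :=
      hg.continuous_fderiv.clm_apply continuous_const
    have hg'm : MemLp (fun x => fderiv ℝ g x (covOp μ h)) p' ν := by
      obtain ⟨C, hC⟩ := hg.bounded_fderiv
      refine MemLp.of_bound hg'.aestronglyMeasurable (C * ‖covOp μ h‖) (ae_of_all _ fun x => ?_)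
      exact (ContinuousLinearMap.le_opNorm _ _).trans (by gcongr; exact hC x)
    have hb : MemLp (fun x => fderiv ℝ g x (covOp μ h) - g x * β l x) p' ν := by
      obtain ⟨C, hC⟩ := hg.bounded
      refine hg'm.sub ((hβ l).of_le_mul (c := C)
        (hg.continuous.aestronglyMeasurable.mul (hβ l).1) (ae_of_all _ fun x => ?_))
      rw [norm_mul]
      gcongr
      exact hC x
    have hK : MemLp (fun x => g x • h) p' ν := by
      obtain ⟨C, hC⟩ := hg.bounded
      have := secondCountableTopologyEither_of_left X (CameronMartin μ)
      refine MemLp.of_bound (hg.continuous.smul continuous_const).aestronglyMeasurable (C * ‖h‖)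
        (ae_of_all _ fun x => ?_)
      rw [norm_smul]
      gcongr
      exact hC x
    -- Both multipliers lie in `L^{p'}(ν)`, so `Λ` is continuous on `L^p × L^p`; this is where the
    -- integrability of `β l` enters.
    let Λ : Lp ℝ p ν × Lp (CameronMartin μ) p ν → ℝ := fun y =>
      (innerSL ℝ).lpPairing ν p p' y.2 hK.toLp +
        (ContinuousLinearMap.mul ℝ ℝ).lpPairing ν p p' y.1 hb.toLp
    have hΛc : Continuous Λ := by
      have h1 : Continuous fun y => (innerSL ℝ).lpPairing ν p p' y hK.toLp :=
        continuous_lpPairing_left _ _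
      have h2 : Continuous fun y =>
          (ContinuousLinearMap.mul ℝ ℝ).lpPairing ν p p' y hb.toLp :=
        continuous_lpPairing_left _ _
      exact (h1.comp continuous_snd).add (h2.comp continuous_fst)
    have hΛ2 : ∀ y : Lp (CameronMartin μ) p ν, (innerSL ℝ).lpPairing ν p p' y hK.toLp =
        ∫ x, g x * inner ℝ (y x) h ∂ν := fun y => by
      rw [ContinuousLinearMap.lpPairing_eq_integral]
      refine integral_congr_ae ?_
      filter_upwards [hK.coeFn_toLp] with x hx
      rw [hx, innerSL_apply_apply]
      exact real_inner_smul_right (y x) h (g x)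
    have hΛ1 : ∀ y : Lp ℝ p ν, (ContinuousLinearMap.mul ℝ ℝ).lpPairing ν p p' y hb.toLp =
        ∫ x, y x * (fderiv ℝ g x (covOp μ h) - g x * β l x) ∂ν := fun y => by
      rw [ContinuousLinearMap.lpPairing_eq_integral]
      refine integral_congr_ae ?_
      filter_upwards [hb.coeFn_toLp] with x hx
      rw [hx, ContinuousLinearMap.mul_apply']
    -- On the graph the integrand is `∂_h(f g) - f g β_l`, whose integral is zero by integration by
    -- parts.
    have hΛ0 : ∀ y ∈ gradGraph μ ν p, Λ y = 0 := by
      rintro ⟨F, Θ⟩ ⟨f, hf, hFf, hΘf⟩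
      have hf1 := hf.isBoundedC1
      simp only [Λ, hΛ1, hΛ2]
      rw [← integral_add, ← hibp l _ (hf1.mul hg)]
      · refine integral_congr_ae ?_
        filter_upwards [hFf, hΘf] with x h1 h2
        rw [h1, h2, inner_gradH μ hf1.differentiable, hf1.fderiv_mul_apply hg]
        ring
      · obtain ⟨C, hC⟩ := hg.bounded
        exact (((Lp.memLp Θ).integrable Fact.out).inner_const h).bdd_mul
          hg.continuous.aestronglyMeasurable (ae_of_all _ hC)
      · exact (Lp.memLp F).integrable_mul hb
    have hz' : Λ z = 0 :=
      closure_minimal hΛ0 (isClosed_eq hΛc continuous_const) hz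
    simp only [Λ, hΛ2, hz0, map_zero, zero_apply, add_zero] at hz'
    exact hz'
  refine Lp.eq_zero_iff_ae_eq_zero.2 (ae_eq_zero_of_forall_inner_dualToCM
    (Lp.aestronglyMeasurable z.2) fun l => ?_)
  exact ae_eq_zero_of_forall_integral_isBoundedC1_mul
    (((Lp.memLp z.2).integrable Fact.out).inner_const _) (key l)

end Closability

end WeightedGaussian

end

/-! ### The theorem: choice of exponents and conclusion. -/

theorem proposition2p2 {X : Type*} [NormedAddCommGroup X] [NormedSpace ℝ X] [CompleteSpace X]
    [SecondCountableTopology X] [MeasurableSpace X] [BorelSpace X]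
    (μ : Measure X) [IsGaussian μ] (hμ : WeightedGaussian.IsCentered μ)
    (hnd : WeightedGaussian.IsNondegenerate μ)
    (s s' t : ℝ) (hs : s.HolderConjugate s') (ht : s' < t)
    (w : X → ℝ) (hw : ∀ᵐ x ∂μ, 0 < w x)
    (hws : WeightedGaussian.MemSobolev μ (ENNReal.ofReal s) w)
    (hwt : WeightedGaussian.MemSobolev μ (ENNReal.ofReal t) (fun x => Real.log (w x)))
    (p : ℝ) [Fact (1 ≤ ENNReal.ofReal p)] (hp : t / (t - s') ≤ p) :
    (∀ f : X → ℝ, WeightedGaussian.IsSmoothCylindrical f →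
      MemLp f (ENNReal.ofReal p) (WeightedGaussian.weighted μ w) ∧
      MemLp (WeightedGaussian.gradH μ f) (ENNReal.ofReal p) (WeightedGaussian.weighted μ w)) ∧
    ∃ T : Lp ℝ (ENNReal.ofReal p) (WeightedGaussian.weighted μ w) →ₗ.[ℝ]
        Lp (WeightedGaussian.CameronMartin μ) (ENNReal.ofReal p) (WeightedGaussian.weighted μ w),
      (∀ F Φ, (F, Φ) ∈ T.graph ↔
        ∃ f : X → ℝ, WeightedGaussian.IsSmoothCylindrical f ∧
          F =ᵐ[WeightedGaussian.weighted μ w] f ∧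
          Φ =ᵐ[WeightedGaussian.weighted μ w] WeightedGaussian.gradH μ f) ∧
      T.IsClosable := by
  have hs'1 : 1 < s' := hs.symm.lt
  have hs'0 : 0 < s' := hs.symm.pos
  have ht0 : 0 < t := hs'0.trans ht
  have hts : 0 < t - s' := sub_pos.2 ht
  have hr1 : 1 < t / (t - s') := (one_lt_div hts).2 (sub_lt_self t hs'0)
  have hpp := Real.HolderConjugate.conjExponent (hr1.trans_le hp)
  have hp0 : 0 < p := hpp.pos
  -- `t/s'` is the conjugate exponent of `t/(t-s')`, and conjugation reverses inequalities.
  have hle : p.conjExponent ≤ t / s' := by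
    have h1 : p⁻¹ ≤ (t / (t - s'))⁻¹ := inv_anti₀ (by positivity) hp
    have h2 : (t / s')⁻¹ ≤ p.conjExponent⁻¹ := by
      rw [← hpp.one_sub_inv]
      have h3 : (t / (t - s'))⁻¹ + (t / s')⁻¹ = 1 := by field_simp; ring
      linarith
    exact (inv_le_inv₀ (div_pos ht0 hs'0) hpp.symm.pos).1 h2
  have hq : 1 ≤ ENNReal.ofReal t := ENNReal.one_le_ofReal.2 (hs'1.trans ht).le
  have : (ENNReal.ofReal p).HolderConjugate (ENNReal.ofReal p.conjExponent) := hpp.ennrealOfReal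
  have : Fact (1 ≤ ENNReal.ofReal p.conjExponent) := ⟨ENNReal.one_le_ofReal.2 hpp.symm.lt.le⟩
  have hwi : Integrable w μ := hws.1.integrable (ENNReal.one_le_ofReal.2 hs.lt.le)
  have := WeightedGaussian.isFiniteMeasure_weighted hwi
  obtain ⟨hlog, Φ, hΦ, F, hF, hFv, hFΦ⟩ := hwt
  have hr : 1 ≤ ENNReal.ofReal (t / s') := ENNReal.one_le_ofReal.2 ((one_lt_div hs'0).2 ht).le
  have hΦν := WeightedGaussian.memLp_weighted hs ht hw hws.1 hΦ
  have hlν := fun l : StrongDual ℝ X => WeightedGaussian.memLp_weighted hs ht hw hws.1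
    (WeightedGaussian.memLp_dual μ l (ENNReal.ofReal_ne_top (r := t)))
  have hclosure := WeightedGaussian.snd_eq_zero_of_mem_closure_gradGraph (μ := μ)
    (ν := WeightedGaussian.weighted μ w) (p := ENNReal.ofReal p)
    (p' := ENNReal.ofReal p.conjExponent)
    (fun l x => l x - inner ℝ (Φ x) (WeightedGaussian.dualToCM μ l))
    (fun l => ((hlν l).sub (hΦν.inner_const _)).mono_exponent (ENNReal.ofReal_le_ofReal hle))
    (fun l G hG => WeightedGaussian.integral_fderiv_weighted hμ hq hw hwi hlog hΦ
      (fun k => (hF k).isBoundedC1) hFv hFΦ (hΦν.integrable hr) ((hlν l).integrable hr) hG)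
  refine ⟨fun f hf => ⟨hf.isBoundedC1.memLp _ _, hf.isBoundedC1.memLp_gradH μ _ _⟩,
    (WeightedGaussian.gradGraph μ (WeightedGaussian.weighted μ w)
      (ENNReal.ofReal p)).toLinearPMap, ?_, ?_⟩
  · intro F Φ
    -- Well-definedness is the special case of the closure statement for points of the graph itself.
    rw [Submodule.toLinearPMap_graph_eq _ fun z hz =>
      hclosure z (Submodule.le_topologicalClosure _ hz)]
    rfl
  · refine ⟨(WeightedGaussian.gradGraph μ (WeightedGaussian.weighted μ w)
      (ENNReal.ofReal p)).topologicalClosure.toLinearPMap, ?_⟩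
    rw [Submodule.toLinearPMap_graph_eq _ hclosure, Submodule.toLinearPMap_graph_eq _ fun z hz =>
      hclosure z (Submodule.le_topologicalClosure _ hz)]
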